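/- Let $\zeta$ denote the Riemann zeta function. There are absolute constants $C>0$ and $T_0$ such that for all real $T\ge T_0$, all real $t$ with $T\le t\le 2T$, and all real $\sigma>\tfrac12$, the function $y\mapsto \big|\log|\zeta(\tfrac12+iy)|-\log|\zeta(\sigma+iy)|\big|$ is (Lebesgue) integrable on $[t-1,t+1]$ and $$\int_{t-1}^{t+1}\Big|\log|\zeta(\tfrac12+iy)|-\log|\zeta(\sigma+iy)|\Big|\,dy\;\le\; C\,(\sigma-\tfrac12)\log T .$$ -/

import Mathlib

/-!
# The L¹ distance of log |ζ| between the critical line and a line to its right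

Near height `t` the function `log |ζ|` is a sum of `O(log t)` logarithmic singularities
`log |s - ρ|`, one for each nearby zero `ρ`, plus a function that is `O(log t)`-Lipschitz.
For a single singularity, `∂ₓ log |x + iy| = x / (x² + y²)` is up to sign a Poisson kernel, whose
integral over all real `y` has absolute value at most `π` for each `x`; hence moving from the line
`Re s = a` to the line `Re s = b` changes `log |s - ρ|` by at most `π |b - a|` in `L¹`, uniformly in
`ρ` (`lintegral_abs_log_norm_sub_le`). Summing over the zeros gives the theorem for `σ ≤ 2`. For
larger `σ` one compares through the line `Re s = 2`, to the right of which `log |ζ|` is bounded.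

The local structure of `log |ζ|` comes from a statement about any bounded holomorphic function on a
disc (`exists_abs_log_norm_sub_le`): the number of zeros is bounded by Jensen's inequality, and the
zero-free cofactor is handled by the Borel–Carathéodory theorem. It is applied in a disc
about `2 + it`, where it needs a polynomial upper bound for `ζ` in a half plane `Re s ≥ ε > 0`
(`norm_riemannZeta_le`, by Euler summation) and a lower bound at the centre
(`abs_log_norm_riemannZeta_le`).
-/

open MeasureTheory Set Metric Filter Topology

/-! ### Logarithmic singularities and the Poisson kernel -/

theorem lintegral_abs_div_sq_add_sq_le (x : ℝ) :
    ∫⁻ y : ℝ, ENNReal.ofReal (|x| / (x ^ 2 + y ^ 2)) ≤ ENNReal.ofReal Real.pi := by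
  rcases eq_or_ne x 0 with rfl | hx
  · simp
  have hfun : (fun y : ℝ => |x| / (x ^ 2 + y ^ 2)) =
      fun y : ℝ => |x|⁻¹ * (1 + (y / x) ^ 2)⁻¹ := by
    funext y
    have h1 : |x| ≠ 0 := abs_ne_zero.mpr hx
    have h2 : x ^ 2 + y ^ 2 ≠ 0 := by positivity
    have h3 : 1 + (y / x) ^ 2 ≠ 0 := by positivity
    field_simp
    rw [sq_abs]
  have hint : Integrable (fun y : ℝ => |x| / (x ^ 2 + y ^ 2)) := by
    rw [hfun]
    exact (integrable_inv_one_add_sq.comp_div hx).const_mul _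
  rw [← ofReal_integral_eq_lintegral_ofReal hint (ae_of_all _ fun y => by positivity), hfun,
    integral_const_mul, Measure.integral_comp_div (fun y : ℝ => (1 + y ^ 2)⁻¹) x,
    integral_univ_inv_one_add_sq, smul_eq_mul, inv_mul_cancel_left₀ (abs_ne_zero.mpr hx)]

/-- The right side is the total variation of `x ↦ log |x + iy|` over `[a, b]`, whose derivative is
`x / (x² + y²)`. Keeping the integral over `x` unevaluated leaves room for Tonelli's theorem. -/
theorem abs_log_sub_log_le_integral {a b y : ℝ} (hab : a ≤ b) (hy : y ≠ 0) :
    ENNReal.ofReal |Real.log ‖(a : ℂ) + Complex.I * y‖ - Real.log ‖(b : ℂ) + Complex.I * y‖| ≤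
      ∫⁻ x in Icc a b, ENNReal.ofReal (|x| / (x ^ 2 + y ^ 2)) := by
  have hnorm (x : ℝ) : Real.log ‖(x : ℂ) + Complex.I * y‖ = Real.log (x ^ 2 + y ^ 2) / 2 := by
    rw [mul_comm, Complex.norm_add_mul_I, Real.log_sqrt (by positivity)]
  have hpos (x : ℝ) : x ^ 2 + y ^ 2 ≠ 0 := by positivity
  have hcont : Continuous fun x : ℝ => x / (x ^ 2 + y ^ 2) := by fun_prop (disch := exact hpos _)
  have hderiv (x : ℝ) : HasDerivAt (fun x : ℝ => Real.log (x ^ 2 + y ^ 2) / 2)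
      (x / (x ^ 2 + y ^ 2)) x := by
    refine ((((hasDerivAt_pow 2 x).add_const (y ^ 2)).log (hpos x)).div_const 2).congr_deriv ?_
    push_cast
    ring
  have hftc := intervalIntegral.integral_eq_sub_of_hasDerivAt (a := a) (b := b)
    (fun x _ => hderiv x) (hcont.intervalIntegrable _ _)
  rw [hnorm, hnorm, abs_sub_comm, ← hftc, ← Real.norm_eq_abs, intervalIntegral.integral_of_le hab,
    ← integral_Icc_eq_integral_Ioc, ofReal_norm]
  refine (enorm_integral_le_lintegral_enorm _).trans (le_of_eq ?_)
  refine lintegral_congr fun x => ?_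
  rw [← ofReal_norm, norm_div, Real.norm_eq_abs, Real.norm_of_nonneg (by positivity)]

/-- A single zero `u` contributes at most `π (b - a)` to the distance in `L¹(ℝ)` between the
restrictions of `log |s - u|` to the lines `Re s = a` and `Re s = b`, wherever `u` lies (on one of
the lines included): by Tonelli the integral over `y` may be taken before that over `x`, and then it
is the total mass `π` of a Poisson kernel. -/
theorem lintegral_abs_log_norm_sub_le (u : ℂ) {a b : ℝ} (hab : a ≤ b) :
    ∫⁻ y : ℝ, ENNReal.ofReal |Real.log ‖(a : ℂ) + Complex.I * y - u‖ -
        Real.log ‖(b : ℂ) + Complex.I * y - u‖| ≤ ENNReal.ofReal (Real.pi * (b - a)) := by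
  have hshift (x y : ℝ) : (x : ℂ) + Complex.I * y - u =
      ((x - u.re : ℝ) : ℂ) + Complex.I * ((y - u.im : ℝ) : ℂ) := by
    apply Complex.ext <;> simp
  simp only [hshift]
  rw [lintegral_sub_right_eq_self (fun y : ℝ => ENNReal.ofReal
    |Real.log ‖((a - u.re : ℝ) : ℂ) + Complex.I * y‖ -
      Real.log ‖((b - u.re : ℝ) : ℂ) + Complex.I * y‖|) u.im]
  calc _ ≤ ∫⁻ y : ℝ, ∫⁻ x in Icc (a - u.re) (b - u.re),
        ENNReal.ofReal (|x| / (x ^ 2 + y ^ 2)) := by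
        refine lintegral_mono_ae ?_
        filter_upwards [compl_mem_ae_iff.mpr (measure_singleton (0 : ℝ))] with y hy
        exact abs_log_sub_log_le_integral (by linarith) hy
    _ = ∫⁻ x in Icc (a - u.re) (b - u.re), ∫⁻ y : ℝ,
        ENNReal.ofReal (|x| / (x ^ 2 + y ^ 2)) := by
        rw [lintegral_lintegral_swap]
        exact Measurable.aemeasurable (by unfold Function.uncurry; fun_prop)
    _ ≤ ∫⁻ _ in Icc (a - u.re) (b - u.re), ENNReal.ofReal Real.pi :=
        lintegral_mono fun x => lintegral_abs_div_sq_add_sq_le x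
    _ = ENNReal.ofReal (Real.pi * (b - a)) := by
        rw [setLIntegral_const, Real.volume_Icc, ← ENNReal.ofReal_mul Real.pi_pos.le]
        ring_nf

/-! ### Bounded holomorphic functions on a disc -/

theorem prod_norm_zero_sub_le_pow {n : ℕ} {u : Fin n → ℂ} {r : ℝ} (hu : ∀ i, ‖u i‖ ≤ r) :
    ∏ i, ‖0 - u i‖ ≤ r ^ n :=
  calc ∏ i, ‖0 - u i‖ ≤ ∏ _i : Fin n, r :=
        Finset.prod_le_prod (fun _ _ => norm_nonneg _) fun i _ => by simpa using hu i
    _ = r ^ n := by simp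

/-- Jensen's inequality in multiplicative form, for a function with `n` zeros split off. -/
theorem norm_mul_pow_le_of_eq_prod_mul {r R R₀ M : ℝ} (hr : 0 < r) (hrR : r < R) (hRR : R < R₀)
    {f G : ℂ → ℂ} (hG : DifferentiableOn ℂ G (ball 0 R₀)) (hM : ∀ z ∈ ball 0 R₀, ‖f z‖ ≤ M)
    {n : ℕ} {u : Fin n → ℂ} (hu : ∀ i, ‖u i‖ ≤ r)
    (hf : ∀ z ∈ ball 0 R₀, f z = (∏ i, (z - u i)) * G z) :
    ‖f 0‖ * (R / r) ^ n ≤ M := by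
  have hR : 0 < R := hr.trans hrR
  have hRC : (R : ℂ) ≠ 0 := by exact_mod_cast hR.ne'
  -- Each factor `z - u` is traded for `R - conj u * z / R`, of the same modulus on `|z| = R`,
  -- but of modulus `R` instead of `|u|` at the origin.
  set H : ℂ → ℂ := fun z => (∏ i, (R - (starRingEnd ℂ) (u i) * z / R)) * G z with hH
  have hsub : closedBall (0 : ℂ) R ⊆ ball 0 R₀ := closedBall_subset_ball hRR
  have hHd : DifferentiableOn ℂ H (closedBall 0 R) := by
    refine DifferentiableOn.mul ?_ (hG.mono hsub)
    fun_prop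
  have hfr : ∀ z ∈ frontier (ball (0 : ℂ) R), ‖H z‖ ≤ M := by
    intro z hz
    rw [frontier_ball _ hR.ne', mem_sphere_zero_iff_norm] at hz
    have hzb : z ∈ ball (0 : ℂ) R₀ := by rw [mem_ball_zero_iff, hz]; exact hRR
    have hfac (w : ℂ) : ‖(R : ℂ) - (starRingEnd ℂ) w * z / R‖ = ‖z - w‖ := by
      have h1 : (R : ℂ) - (starRingEnd ℂ) w * z / R = (starRingEnd ℂ) (z - w) * z / R := by
        have h2 : (starRingEnd ℂ) z * z = (R : ℂ) * R := by
          rw [mul_comm, Complex.mul_conj, Complex.normSq_eq_norm_sq, hz]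
          push_cast
          ring
        rw [map_sub, sub_mul, h2, sub_div, mul_div_assoc (R : ℂ), div_self hRC, mul_one]
      rw [h1, norm_div, norm_mul, RCLike.norm_conj, hz, Complex.norm_real, Real.norm_of_nonneg hR.le,
        mul_div_assoc, div_self hR.ne', mul_one]
    have : ‖H z‖ = ‖f z‖ := by
      rw [hf z hzb, hH]
      simp only [norm_mul, norm_prod, hfac]
    rw [this]
    exact hM z hzb
  have hH0 : ‖H 0‖ ≤ M :=
    Complex.norm_le_of_forall_mem_frontier_norm_le isBounded_ball
      (hHd.diffContOnCl_ball subset_rfl) hfr (subset_closure (mem_ball_self hR))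
  have hH0' : ‖H 0‖ = R ^ n * ‖G 0‖ := by
    simp [hH, abs_of_pos hR]
  have hf0 : ‖f 0‖ ≤ r ^ n * ‖G 0‖ := by
    rw [hf 0 (mem_ball_self (hR.trans hRR)), norm_mul, norm_prod]
    gcongr
    exact prod_norm_zero_sub_le_pow hu
  calc ‖f 0‖ * (R / r) ^ n ≤ r ^ n * ‖G 0‖ * (R / r) ^ n := by gcongr
    _ = R ^ n * ‖G 0‖ := by
      rw [div_pow]
      field_simp
    _ ≤ M := hH0' ▸ hH0

/-- Jensen's bound for the number of zeros of `f` in the disc of radius `r`. -/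
theorem natCast_mul_log_le_of_eq_prod_mul {r R R₀ M : ℝ} (hr : 0 < r) (hrR : r < R) (hRR : R < R₀)
    {f G : ℂ → ℂ} (hG : DifferentiableOn ℂ G (ball 0 R₀)) (hM : ∀ z ∈ ball 0 R₀, ‖f z‖ ≤ M)
    (hf0 : f 0 ≠ 0) {n : ℕ} {u : Fin n → ℂ} (hu : ∀ i, ‖u i‖ ≤ r)
    (hf : ∀ z ∈ ball 0 R₀, f z = (∏ i, (z - u i)) * G z) :
    n * Real.log (R / r) ≤ Real.log (M / ‖f 0‖) := by
  have hR : 0 < R := hr.trans hrR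
  have h0 : 0 < ‖f 0‖ := norm_pos_iff.mpr hf0
  rw [← Real.log_pow]
  refine Real.log_le_log (by positivity) ?_
  rw [le_div_iff₀ h0, mul_comm]
  exact norm_mul_pow_le_of_eq_prod_mul hr hrR hRR hG hM hu hf

/-- All zeros of `f` in the closed disc of radius `r` can be split off, repeated according to
multiplicity. Jensen's bound limits how many factors can be split off at all, and the cofactor of a
longest product cannot vanish, since `dslope` would extract another factor. -/
theorem exists_eq_prod_mul {r R R₀ M : ℝ} (hr : 0 < r) (hrR : r < R) (hRR : R < R₀)
    {f : ℂ → ℂ} (hfd : DifferentiableOn ℂ f (ball 0 R₀)) (hM : ∀ z ∈ ball 0 R₀, ‖f z‖ ≤ M)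
    (hf0 : f 0 ≠ 0) :
    ∃ (n : ℕ) (u : Fin n → ℂ) (G : ℂ → ℂ), DifferentiableOn ℂ G (ball 0 R₀) ∧
      (∀ i, ‖u i‖ ≤ r) ∧ (∀ z ∈ ball 0 R₀, f z = (∏ i, (z - u i)) * G z) ∧
      ∀ z ∈ closedBall 0 r, G z ≠ 0 := by
  set S : Set ℕ := {n | ∃ (u : Fin n → ℂ) (G : ℂ → ℂ), DifferentiableOn ℂ G (ball 0 R₀) ∧
      (∀ i, ‖u i‖ ≤ r) ∧ ∀ z ∈ ball 0 R₀, f z = (∏ i, (z - u i)) * G z} with hS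
  have hne : S.Nonempty := ⟨0, Fin.elim0, f, hfd, fun i => i.elim0, by simp⟩
  have hlog : 0 < Real.log (R / r) := Real.log_pos ((one_lt_div hr).mpr hrR)
  have hbdd : BddAbove S := by
    refine ⟨⌊Real.log (M / ‖f 0‖) / Real.log (R / r)⌋₊, ?_⟩
    rintro n ⟨u, G, hG, hu, hf⟩
    refine Nat.le_floor ((le_div_iff₀ hlog).mpr ?_)
    exact natCast_mul_log_le_of_eq_prod_mul hr hrR hRR hG hM hf0 hu hf
  obtain ⟨u, G, hG, hu, hf⟩ := Nat.sSup_mem hne hbdd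
  refine ⟨sSup S, u, G, hG, hu, hf, fun a ha hGa => ?_⟩
  have har : ‖a‖ ≤ r := mem_closedBall_zero_iff.mp ha
  have hab : a ∈ ball (0 : ℂ) R₀ := by
    rw [mem_ball_zero_iff]
    linarith
  have hmem : sSup S + 1 ∈ S := by
    refine ⟨Fin.cons a u, dslope G a,
      (Complex.differentiableOn_dslope (isOpen_ball.mem_nhds hab)).mpr hG, ?_, fun z hz => ?_⟩
    · intro i
      refine Fin.cases ?_ (fun j => ?_) i
      · simpa using har
      · simpa using hu j
    · have h1 := sub_smul_dslope G a z
      rw [hGa, sub_zero, smul_eq_mul] at h1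
      rw [hf z hz, ← h1, Fin.prod_univ_succ]
      simp only [Fin.cons_zero, Fin.cons_succ]
      ring
  have := le_csSup hbdd hmem
  omega

/-- For a zero-free `G`, a one-sided bound on `log |G|` makes it Lipschitz on smaller discs:
`log (G / G 0)` has a holomorphic branch `h`, bounded by the Borel–Carathéodory theorem, and Cauchy's
estimate bounds `h'`. -/
theorem abs_log_norm_sub_log_norm_le {r r₁ B : ℝ} (hr : 0 < r) (hrr : r < r₁) (hB : 0 < B)
    {G : ℂ → ℂ} (hG : DifferentiableOn ℂ G (ball 0 r₁)) (hG0 : ∀ z ∈ ball 0 r₁, G z ≠ 0)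
    (hGB : ∀ z ∈ ball 0 r₁, Real.log ‖G z‖ ≤ Real.log ‖G 0‖ + B) {z w : ℂ}
    (hz : z ∈ closedBall 0 r) (hw : w ∈ closedBall 0 r) :
    |Real.log ‖G z‖ - Real.log ‖G w‖| ≤ 8 * r₁ / (r₁ - r) ^ 2 * B * ‖z - w‖ := by
  have hr₁ : 0 < r₁ := hr.trans hrr
  have h0 : (0 : ℂ) ∈ ball (0 : ℂ) r₁ := mem_ball_self hr₁
  have hd : DifferentiableOn ℂ (fun z => deriv G z / G z) (ball 0 r₁) :=
    (hG.deriv isOpen_ball).div hG hG0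
  -- `h` is the branch of `log (G / G 0)` that vanishes at the origin.
  obtain ⟨h, hh0, hh⟩ := hd.isExactOn_ball.with_val_at 0 0
  have hGd : ∀ z ∈ ball (0 : ℂ) r₁, HasDerivAt G (deriv G z) z := fun z hz =>
    (hG.differentiableAt (isOpen_ball.mem_nhds hz)).hasDerivAt
  have hexp : ∀ z ∈ ball (0 : ℂ) r₁, G z = G 0 * Complex.exp (h z) := by
    intro z hz
    have hconst := (convex_ball (0 : ℂ) r₁).is_const_of_fderivWithin_eq_zero (𝕜 := ℂ)
      (f := fun z => G z * Complex.exp (-h z)) ?_ ?_ hz h0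
    · simp only [hh0, neg_zero, Complex.exp_zero, mul_one] at hconst
      rw [← hconst, mul_assoc, ← Complex.exp_add]
      simp
    · intro z hz
      exact ((hGd z hz).mul (hh z hz).neg.cexp).differentiableAt.differentiableWithinAt
    · intro z hz
      have : HasDerivAt (fun z => G z * Complex.exp (-h z)) 0 z := by
        refine ((hGd z hz).mul (hh z hz).neg.cexp).congr_deriv ?_
        have := hG0 z hz
        field_simp
        ring
      have h2 := this.hasFDerivAt.hasFDerivWithinAt (s := ball 0 r₁)
      rw [h2.fderivWithin (isOpen_ball.uniqueDiffWithinAt hz)]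
      simp
  have hre : ∀ z ∈ ball (0 : ℂ) r₁, Real.log ‖G z‖ = Real.log ‖G 0‖ + (h z).re := by
    intro z hz
    rw [hexp z hz, norm_mul, Complex.norm_exp, Real.log_mul (norm_ne_zero_iff.mpr (hG0 0 h0))
      (Real.exp_pos _).ne', Real.log_exp]
  have hhd : DifferentiableOn ℂ h (ball 0 r₁) := fun z hz =>
    (hh z hz).differentiableAt.differentiableWithinAt
  have hmaps : MapsTo h (ball 0 r₁) {z | z.re ≤ B} := fun z hz => by
    have h1 := hGB z hz
    have h2 := hre z hz
    simp only [mem_ofPred_eq]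
    linarith
  set δ := (r₁ - r) / 2 with hδ
  have hδ0 : 0 < δ := by rw [hδ]; linarith
  have hderiv : ∀ z ∈ closedBall (0 : ℂ) r, ‖deriv h z‖ ≤ 8 * r₁ / (r₁ - r) ^ 2 * B := by
    intro z hz
    rw [mem_closedBall_zero_iff] at hz
    have hsub : closedBall z δ ⊆ closedBall 0 (r + δ) := by
      refine closedBall_subset_closedBall' ?_
      rw [dist_zero_right]
      linarith
    have hsub' : closedBall (0 : ℂ) (r + δ) ⊆ ball 0 r₁ :=
      closedBall_subset_ball (by rw [hδ]; linarith)
    have hC : ∀ w ∈ sphere z δ, ‖h w‖ ≤ 2 * B * r₁ / δ := by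
      intro w hw
      have hw1 := hsub (sphere_subset_closedBall hw)
      refine (Complex.borelCaratheodory_zero hB hhd hmaps hr₁ (hsub' hw1) hh0).trans ?_
      rw [mem_closedBall_zero_iff] at hw1
      gcongr
      · linarith
      · rw [hδ] at hw1 ⊢; linarith
    have := Complex.norm_deriv_le_of_forall_mem_sphere_norm_le hδ0
      (hhd.diffContOnCl_ball (hsub.trans hsub')) hC
    refine this.trans (le_of_eq ?_)
    rw [hδ]
    have : r₁ - r ≠ 0 := by linarith
    field_simp
    ring
  have hsub : closedBall (0 : ℂ) r ⊆ ball 0 r₁ := closedBall_subset_ball hrr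
  rw [hre z (hsub hz), hre w (hsub hw), add_sub_add_left_eq_sub, ← Complex.sub_re]
  refine (Complex.abs_re_le_norm _).trans ?_
  exact (convex_closedBall (0 : ℂ) r).norm_image_sub_le_of_norm_deriv_le
    (fun x hx => (hh x (hsub hx)).differentiableAt) hderiv hw hz

/-- Local structure of `log |f|` in a disc: up to a Lipschitz error it is a sum of logarithmic
singularities at the zeros, and both the number of zeros and the Lipschitz constant are controlled
by `log (M / |f 0|)`, with a constant that depends only on the radii. The summand `1` keeps the
bound positive when `f` is constant. -/
theorem exists_abs_log_norm_sub_le {r R₀ : ℝ} (hr : 0 < r) (hrR : r < R₀) :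
    ∃ C : ℝ, 0 < C ∧ ∀ (f : ℂ → ℂ) (M : ℝ), DifferentiableOn ℂ f (ball 0 R₀) → f 0 ≠ 0 →
      (∀ z ∈ ball 0 R₀, ‖f z‖ ≤ M) →
      ∃ (n : ℕ) (u : Fin n → ℂ), n ≤ C * (Real.log (M / ‖f 0‖) + 1) ∧
        (∀ z ∈ closedBall 0 r, f z = 0 → ∃ i, z = u i) ∧
        ∀ z ∈ closedBall 0 r, ∀ w ∈ closedBall 0 r, f z ≠ 0 → f w ≠ 0 →
          |Real.log ‖f z‖ - Real.log ‖f w‖| ≤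
            ∑ i, |Real.log ‖z - u i‖ - Real.log ‖w - u i‖| +
              C * (Real.log (M / ‖f 0‖) + 1) * ‖z - w‖ := by
  obtain ⟨r₁, hr1, hr1'⟩ := exists_between hrR
  obtain ⟨R, hR1, hR2⟩ := exists_between hr1'
  have hr₁ : 0 < r₁ := hr.trans hr1
  have hR : 0 < R := hr₁.trans hR1
  set L := Real.log (R / r₁) with hL
  have hL0 : 0 < L := Real.log_pos ((one_lt_div hr₁).mpr hR1)
  set E := |Real.log (r₁ / (R - r₁))| with hE
  have hE0 : 0 ≤ E := abs_nonneg _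
  set D := 8 * r₁ / (r₁ - r) ^ 2 with hD
  have hD0 : 0 < D := by
    have : 0 < r₁ - r := by linarith
    positivity
  set C := max (1 / L) (D * (1 + E / L)) with hC
  have hC1 : 1 / L ≤ C := le_max_left _ _
  have hC2 : D * (1 + E / L) ≤ C := le_max_right _ _
  refine ⟨C, lt_of_lt_of_le (by positivity) hC1, fun f M hfd hf0 hM => ?_⟩
  obtain ⟨n, u, G, hG, hu, hf, hGne⟩ := exists_eq_prod_mul hr₁ hR1 hR2 hfd hM hf0
  have hn := natCast_mul_log_le_of_eq_prod_mul hr₁ hR1 hR2 hG hM hf0 hu hf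
  set K := Real.log (M / ‖f 0‖) with hK
  have hK0 : 0 ≤ K := le_trans (by positivity) hn
  have hnL : (n : ℝ) ≤ K / L := (le_div_iff₀ hL0).mpr hn
  have hf0' : 0 < ‖f 0‖ := norm_pos_iff.mpr hf0
  have hM0 : 0 < M := hf0'.trans_le (hM 0 (mem_ball_self (hR.trans hR2)))
  set B := (1 + E / L) * (K + 1) with hB
  have hB0 : 0 < B := by positivity
  have hsubR : closedBall (0 : ℂ) R ⊆ ball 0 R₀ := closedBall_subset_ball hR2
  -- Only the zeros in the disc of radius `r₁ < R` are removed, so that on `|z| = R` every removed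
  -- factor is at least `R - r₁` in modulus.
  have hGR : ∀ z ∈ closedBall (0 : ℂ) R, ‖G z‖ ≤ M / (R - r₁) ^ n := by
    intro z hz
    refine Complex.norm_le_of_forall_mem_frontier_norm_le (isBounded_ball (x := (0 : ℂ)) (r := R))
      (hG.diffContOnCl_ball hsubR) (fun z hz => ?_) (by rwa [closure_ball _ hR.ne'])
    rw [frontier_ball _ hR.ne'] at hz
    have hzb := hsubR (sphere_subset_closedBall hz)
    rw [mem_sphere_zero_iff_norm] at hz
    have hRr : 0 < R - r₁ := by linarith
    rw [le_div_iff₀ (by positivity), mul_comm]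
    refine le_trans ?_ (hM z hzb)
    rw [hf z hzb, norm_mul, norm_prod]
    gcongr
    calc (R - r₁) ^ n = ∏ _i : Fin n, (R - r₁) := by simp
      _ ≤ _ := Finset.prod_le_prod (fun _ _ => hRr.le) fun i _ => by
        have := norm_sub_norm_le z (u i)
        have := hu i
        linarith
  have hG0 : 0 < ‖G 0‖ := norm_pos_iff.mpr (hGne 0 (mem_closedBall_self hr₁.le))
  have hf0G : ‖f 0‖ ≤ r₁ ^ n * ‖G 0‖ := by
    rw [hf 0 (mem_ball_self (hR.trans hR2)), norm_mul, norm_prod]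
    gcongr
    exact prod_norm_zero_sub_le_pow hu
  have hGB : ∀ z ∈ ball (0 : ℂ) r₁, Real.log ‖G z‖ ≤ Real.log ‖G 0‖ + B := by
    intro z hz
    have hRr : 0 < R - r₁ := by linarith
    have hGz : 0 < ‖G z‖ := norm_pos_iff.mpr (hGne z (ball_subset_closedBall hz))
    have h1 := Real.log_le_log hGz
      (hGR z (ball_subset_closedBall.trans (closedBall_subset_closedBall hR1.le) hz))
    have h2 := Real.log_le_log hf0' hf0G
    rw [Real.log_div hM0.ne' (by positivity), Real.log_pow] at h1
    rw [Real.log_mul (by positivity) hG0.ne', Real.log_pow] at h2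
    have h3 : K = Real.log M - Real.log ‖f 0‖ := Real.log_div hM0.ne' hf0'.ne'
    have h4 : Real.log r₁ - Real.log (R - r₁) ≤ E := by
      rw [← Real.log_div hr₁.ne' hRr.ne']
      exact le_abs_self _
    have h5 : (n : ℝ) * (Real.log r₁ - Real.log (R - r₁)) ≤ K / L * E :=
      (mul_le_mul_of_nonneg_left h4 (Nat.cast_nonneg n)).trans
        (mul_le_mul_of_nonneg_right hnL hE0)
    have h6 : K + K / L * E ≤ B := by
      have : B = K + K / L * E + (1 + E / L) := by rw [hB]; ring
      have : 0 ≤ E / L := by positivity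
      linarith
    linarith
  refine ⟨n, u, ?_, ?_, ?_⟩
  · calc (n : ℝ) ≤ 1 / L * K := by rw [one_div_mul_eq_div]; exact hnL
      _ ≤ C * (K + 1) := by gcongr; linarith
  · intro z hz hfz
    have hz1 := closedBall_subset_closedBall hr1.le hz
    rw [hf z (closedBall_subset_ball hrR hz), mul_eq_zero, or_iff_left (hGne z hz1),
      Finset.prod_eq_zero_iff] at hfz
    obtain ⟨i, -, hi⟩ := hfz
    exact ⟨i, sub_eq_zero.mp hi⟩
  · intro z hz w hw hfz hfw
    have hlog : ∀ z ∈ closedBall (0 : ℂ) r, f z ≠ 0 →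
        Real.log ‖f z‖ = ∑ i, Real.log ‖z - u i‖ + Real.log ‖G z‖ := by
      intro z hz hfz
      have hzf := hf z (closedBall_subset_ball hrR hz)
      rw [hzf] at hfz
      rw [hzf, norm_mul, norm_prod, Real.log_mul, Real.log_prod]
      · intro i _
        exact norm_ne_zero_iff.mpr (Finset.prod_ne_zero_iff.mp (left_ne_zero_of_mul hfz) i
          (Finset.mem_univ i))
      · rw [← norm_prod]
        exact norm_ne_zero_iff.mpr (left_ne_zero_of_mul hfz)
      · exact norm_ne_zero_iff.mpr (right_ne_zero_of_mul hfz)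
    rw [hlog z hz hfz, hlog w hw hfw, add_sub_add_comm, ← Finset.sum_sub_distrib]
    refine (abs_add_le _ _).trans (add_le_add (Finset.abs_sum_le_sum_abs _ _) ?_)
    refine (abs_log_norm_sub_log_norm_le hr hr1 hB0
      (hG.mono (ball_subset_ball (hr1'.le))) (fun z hz => hGne z (ball_subset_closedBall hz))
      hGB hz hw).trans ?_
    have : D * B ≤ C * (K + 1) := by
      rw [hB, ← mul_assoc]
      gcongr
    gcongr

/-! ### Bounds for the zeta function -/

/-- The difference `a ^ (-s) - ∫ x in a..a+1, x ^ (-s)`, with the integral evaluated, so that the term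
is visibly holomorphic in `s ≠ 1`. -/
noncomputable def zetaTerm (a : ℝ) (s : ℂ) : ℂ :=
  (a : ℂ) ^ (-s) - (((a + 1 : ℝ) : ℂ) ^ (-s + 1) - (a : ℂ) ^ (-s + 1)) / (-s + 1)

/-- The integrand `a ^ (-s) - x ^ (-s)` is estimated by the mean value inequality, and the integral
by a second use of it, applied to a primitive. -/
theorem norm_zetaTerm_le {a : ℝ} (ha : 0 < a) {s : ℂ} (hs : 0 < s.re) (hs1 : s ≠ 1) :
    ‖zetaTerm a s‖ ≤ ‖s‖ * a ^ (-s.re - 1) := by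
  have hs0 : s ≠ 0 := fun h => by simp [h] at hs
  have hpow : ∀ x ∈ Icc a (a + 1), ‖(a : ℂ) ^ (-s) - (x : ℂ) ^ (-s)‖ ≤ ‖s‖ * a ^ (-s.re - 1) := by
    intro x hx
    have hd : ∀ y ∈ Icc a (a + 1), HasDerivWithinAt (fun y : ℝ => (y : ℂ) ^ (-s))
        (-s * (y : ℂ) ^ (-s - 1)) (Icc a (a + 1)) y := fun y hy =>
      (hasDerivAt_ofReal_cpow_const (ha.trans_le hy.1).ne' (neg_ne_zero.mpr hs0)).hasDerivWithinAt
    have hb : ∀ y ∈ Ico a (a + 1), ‖-s * (y : ℂ) ^ (-s - 1)‖ ≤ ‖s‖ * a ^ (-s.re - 1) := by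
      intro y hy
      rw [norm_mul, norm_neg, Complex.norm_cpow_eq_rpow_re_of_pos (ha.trans_le hy.1)]
      simp only [Complex.sub_re, Complex.neg_re, Complex.one_re]
      exact mul_le_mul_of_nonneg_left
        (Real.rpow_le_rpow_of_nonpos ha hy.1 (by linarith)) (norm_nonneg _)
    have := norm_image_sub_le_of_norm_deriv_le_segment' hd hb x hx
    rw [norm_sub_rev]
    refine this.trans (mul_le_of_le_one_right (by positivity) ?_)
    linarith [hx.2]
  have hne : -s + 1 ≠ 0 := fun h => hs1 (by linear_combination -h)
  have hd : ∀ y ∈ Icc a (a + 1), HasDerivWithinAt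
      (fun y : ℝ => (y : ℂ) * (a : ℂ) ^ (-s) - (y : ℂ) ^ (-s + 1) / (-s + 1))
      ((a : ℂ) ^ (-s) - (y : ℂ) ^ (-s)) (Icc a (a + 1)) y := by
    intro y hy
    refine HasDerivAt.hasDerivWithinAt (HasDerivAt.sub ?_ ?_)
    · simpa using (Complex.ofRealCLM.hasDerivAt (x := y)).mul_const ((a : ℂ) ^ (-s))
    · exact hasDerivAt_ofReal_cpow_const' (ha.trans_le hy.1).ne'
        fun h => hne (by rw [h]; ring)
  have := norm_image_sub_le_of_norm_deriv_le_segment' hd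
    (fun y hy => hpow y (Ico_subset_Icc_self hy)) (a + 1) (right_mem_Icc.mpr (by linarith))
  rw [add_sub_cancel_left, mul_one] at this
  refine le_trans (le_of_eq ?_) this
  rw [zetaTerm]
  congr 1
  push_cast
  ring

theorem summable_zetaTerm_bound {ε : ℝ} (hε : 0 < ε) :
    Summable fun n : ℕ => ((n : ℝ) + 1) ^ (-ε - 1) := by
  have := (summable_nat_add_iff 1).mpr (Real.summable_nat_rpow (p := -ε - 1) |>.mpr (by linarith))
  simpa using this

theorem hasSum_riemannZeta_of_one_lt_re {s : ℂ} (hs : 1 < s.re) :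
    HasSum (fun n : ℕ => 1 / ((n : ℂ) + 1) ^ s) (riemannZeta s) := by
  rw [zeta_eq_tsum_one_div_nat_add_one_cpow hs]
  have hsum : Summable fun n : ℕ => 1 / ((n : ℂ) + 1) ^ s := by
    have := (summable_nat_add_iff 1).mpr (Complex.summable_one_div_nat_cpow.mpr hs)
    simpa using this
  exact hsum.hasSum

theorem riemannZeta_eq_tsum_of_one_lt_re {s : ℂ} (hs : 1 < s.re) :
    riemannZeta s = 1 / (s - 1) + ∑' n : ℕ, zetaTerm (n + 1) s := by
  have hs1 : s ≠ 1 := fun h => by simp [h] at hs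
  have hne : -s + 1 ≠ 0 := fun h => hs1 (by linear_combination -h)
  have hne' : s - 1 ≠ 0 := sub_ne_zero.mpr hs1
  have h1 : HasSum (fun n : ℕ => (((n + 1 : ℝ) : ℂ)) ^ (-s)) (riemannZeta s) := by
    convert hasSum_riemannZeta_of_one_lt_re hs using 2 with n
    rw [Complex.cpow_neg, one_div]
    push_cast
    rfl
  have hsummable : Summable fun n : ℕ => zetaTerm (n + 1) s := by
    refine Summable.of_norm_bounded ((summable_zetaTerm_bound (ε := s.re)
      (by linarith)).mul_left ‖s‖) fun n => ?_
    exact norm_zetaTerm_le (by positivity) (by linarith) hs1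
  have h2 := h1.sub hsummable.hasSum
  have h3 : HasSum (fun n : ℕ => (((n + 1 : ℝ) : ℂ)) ^ (-s) - zetaTerm (n + 1) s)
      (1 / (s - 1)) := by
    set g : ℕ → ℂ := fun m => ((m + 1 : ℝ) : ℂ) ^ (-s + 1) / (-s + 1) with hg
    have heq (n : ℕ) : (((n + 1 : ℝ) : ℂ)) ^ (-s) - zetaTerm (n + 1) s = g (n + 1) - g n := by
      simp only [zetaTerm, hg]
      push_cast
      ring
    have hg0 : 0 - g 0 = 1 / (s - 1) := by
      simp only [hg, Nat.cast_zero, zero_add, Complex.ofReal_one, Complex.one_cpow]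
      field_simp
      ring
    rw [← hg0, (h1.summable.sub hsummable).hasSum_iff_tendsto_nat]
    simp only [heq, Finset.sum_range_sub]
    have hlim : Tendsto g atTop (𝓝 0) := by
      rw [tendsto_zero_iff_norm_tendsto_zero]
      have h4 : Tendsto (fun n : ℕ => ((n : ℝ) + 1) ^ (-(s.re - 1)) / ‖-s + 1‖) atTop
          (𝓝 (0 / ‖-s + 1‖)) := by
        refine Tendsto.div_const ?_ _
        exact (tendsto_rpow_neg_atTop (by linarith)).comp
          (tendsto_natCast_atTop_atTop.atTop_add tendsto_const_nhds)
      rw [zero_div] at h4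
      refine h4.congr fun n => ?_
      rw [norm_div, Complex.norm_cpow_eq_rpow_re_of_pos (by positivity)]
      congr 2
      simp
      ring
    exact hlim.sub_const _
  have := h2.unique h3
  linear_combination this

/-- The expansion of `ζ` by Euler summation persists to the left of `Re s = 1`. In the open first
quadrant the pole plays no role and the domain is convex, so the identity theorem applies. -/
theorem riemannZeta_eq_tsum_of_pos_im {s : ℂ} (hs : 0 < s.re) (hs' : 0 < s.im) :
    riemannZeta s = 1 / (s - 1) + ∑' n : ℕ, zetaTerm (n + 1) s := by
  obtain ⟨ε, hε0, hε⟩ := exists_between (lt_min hs one_pos)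
  obtain ⟨hεs, hε1⟩ := lt_min_iff.mp hε
  -- A bounded piece of the quadrant, where the series converges uniformly; the radius leaves room
  -- for the point `2 + i`, near which the Dirichlet series is available.
  set B : ℝ := ‖s‖ + 3 with hB
  set U : Set ℂ := {z | ε < z.re} ∩ {z | 0 < z.im} ∩ ball 0 B with hU
  have hUo : IsOpen U := ((isOpen_lt continuous_const Complex.continuous_re).inter
    (isOpen_lt continuous_const Complex.continuous_im)).inter isOpen_ball
  have hUc : Convex ℝ U := ((convex_halfSpace_re_gt ε).inter (convex_halfSpace_im_gt 0)).inter
    (convex_ball 0 B)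
  have hU1 : ∀ z ∈ U, z ≠ 1 := by
    rintro z ⟨⟨-, hz⟩, -⟩ rfl
    simp at hz
  have hsU : s ∈ U := ⟨⟨hεs, hs'⟩, by rw [mem_ball_zero_iff, hB]; linarith⟩
  have hpU : (2 + Complex.I : ℂ) ∈ U := by
    refine ⟨⟨?_, ?_⟩, ?_⟩
    · simp only [mem_ofPred_eq, Complex.add_re, Complex.re_ofNat, Complex.I_re]; linarith
    · simp
    · rw [mem_ball_zero_iff]
      have h1 := norm_add_le (2 : ℂ) Complex.I
      rw [Complex.norm_I, RCLike.norm_ofNat] at h1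
      have : s ≠ 0 := fun h => by simp [h] at hs
      have : 0 < ‖s‖ := norm_pos_iff.mpr this
      linarith
  have hda : DifferentiableOn ℂ riemannZeta U := fun z hz =>
    (differentiableAt_riemannZeta (hU1 z hz)).differentiableWithinAt
  have hdb : DifferentiableOn ℂ (fun z => 1 / (z - 1) + ∑' n : ℕ, zetaTerm (n + 1) z) U := by
    refine DifferentiableOn.add ?_ ?_
    · refine DifferentiableOn.div (by fun_prop) (by fun_prop) fun z hz => ?_
      exact sub_ne_zero.mpr (hU1 z hz)
    · refine Complex.differentiableOn_tsum_of_summable_norm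
        ((summable_zetaTerm_bound hε0).mul_left B) (fun n z hz => ?_) hUo fun n z hz => ?_
      · have h1 : (((n + 1 : ℝ) : ℝ) : ℂ) ≠ 0 := by
          exact_mod_cast (by positivity : ((n : ℝ) + 1) ≠ 0)
        have h2 : (((n + 1 : ℝ) + 1 : ℝ) : ℂ) ≠ 0 := by
          exact_mod_cast (by positivity : ((n : ℝ) + 1 + 1) ≠ 0)
        have h3 : -z + 1 ≠ 0 := fun h => hU1 z hz (by linear_combination -h)
        refine DifferentiableAt.differentiableWithinAt ?_
        unfold zetaTerm
        refine DifferentiableAt.sub ?_ (DifferentiableAt.div (DifferentiableAt.sub ?_ ?_) ?_ h3)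
        · exact DifferentiableAt.const_cpow (by fun_prop) (Or.inl h1)
        · exact DifferentiableAt.const_cpow (by fun_prop) (Or.inl h2)
        · exact DifferentiableAt.const_cpow (by fun_prop) (Or.inl h1)
        · fun_prop
      · obtain ⟨⟨hz1, -⟩, hz2⟩ := id hz
        rw [mem_ball_zero_iff] at hz2
        simp only [mem_ofPred_eq] at hz1
        refine (norm_zetaTerm_le (by positivity) (by linarith) (hU1 z hz)).trans ?_
        have : (1 : ℝ) ≤ (n : ℝ) + 1 := by linarith [(Nat.cast_nonneg n : (0 : ℝ) ≤ n)]
        gcongr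
  refine (hda.analyticOnNhd hUo).eqOn_of_preconnected_of_eventuallyEq (hdb.analyticOnNhd hUo)
    hUc.isPreconnected hpU ?_ hsU
  have : ∀ᶠ z : ℂ in 𝓝 (2 + Complex.I), 1 < z.re :=
    (isOpen_lt continuous_const Complex.continuous_re).mem_nhds (by simp)
  filter_upwards [this] with z hz
  exact riemannZeta_eq_tsum_of_one_lt_re hz

theorem norm_riemannZeta_le {ε : ℝ} (hε : 0 < ε) {s : ℂ} (hs : ε ≤ s.re) (hs' : 0 < s.im) :
    ‖riemannZeta s‖ ≤ 1 / ‖s - 1‖ + ‖s‖ * ∑' n : ℕ, ((n : ℝ) + 1) ^ (-ε - 1) := by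
  have hs1 : s ≠ 1 := fun h => by simp [h] at hs'
  rw [riemannZeta_eq_tsum_of_pos_im (hε.trans_le hs) hs']
  refine (norm_add_le _ _).trans (add_le_add (by simp) ?_)
  refine tsum_of_norm_bounded ((summable_zetaTerm_bound hε).hasSum.mul_left ‖s‖) fun n => ?_
  refine (norm_zetaTerm_le (by positivity) (hε.trans_le hs) hs1).trans ?_
  have : (1 : ℝ) ≤ (n : ℝ) + 1 := by linarith [(Nat.cast_nonneg n : (0 : ℝ) ≤ n)]
  gcongr

theorem norm_riemannZeta_sub_one_le {s : ℂ} (hs : 2 ≤ s.re) :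
    ‖riemannZeta s - 1‖ ≤ 2 / 3 := by
  have h1 := hasSum_riemannZeta_of_one_lt_re (show 1 < s.re by linarith)
  have h2 : HasSum (fun n : ℕ => 1 / (((n + 1 : ℕ) : ℂ) + 1) ^ s) (riemannZeta s - 1) := by
    simpa using (hasSum_nat_add_iff' 1).mpr h1
  have h3 : HasSum (fun n : ℕ => 1 / (((n + 2 : ℕ) : ℝ)) ^ 2) (Real.pi ^ 2 / 6 - 1) := by
    have := (hasSum_nat_add_iff' 2).mpr hasSum_zeta_two
    simpa [Finset.sum_range_succ] using this
  rw [← h2.tsum_eq]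
  refine (tsum_of_norm_bounded h3 fun n => ?_).trans ?_
  · have h4 : (((n + 1 : ℕ) : ℂ) + 1) = (((n + 2 : ℕ) : ℝ) : ℂ) := by push_cast; ring
    rw [h4, norm_div, norm_one, Complex.norm_cpow_eq_rpow_re_of_pos (by positivity),
      ← Real.rpow_natCast _ 2]
    have : (1 : ℝ) ≤ ((n + 2 : ℕ) : ℝ) := by exact_mod_cast (by omega)
    gcongr
    exact_mod_cast hs
  · have := Real.pi_lt_d2
    have := Real.pi_pos
    nlinarith

theorem abs_log_norm_riemannZeta_le {s : ℂ} (hs : 2 ≤ s.re) :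
    |Real.log ‖riemannZeta s‖| ≤ 2 := by
  have h := norm_riemannZeta_sub_one_le hs
  have h1 : 1 / 3 ≤ ‖riemannZeta s‖ := by
    have := norm_sub_norm_le (1 : ℂ) (riemannZeta s)
    rw [norm_one, norm_sub_rev] at this
    linarith
  have h2 : ‖riemannZeta s‖ ≤ 5 / 3 := by
    have := norm_sub_norm_le (riemannZeta s) 1
    rw [norm_one] at this
    linarith
  have h0 : 0 < ‖riemannZeta s‖ := by linarith
  rw [abs_le]
  constructor
  · have h3 := Real.one_sub_inv_le_log_of_pos h0
    have h4 : ‖riemannZeta s‖⁻¹ ≤ 3 := by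
      rw [inv_le_comm₀ h0 (by norm_num)]
      linarith
    linarith
  · have := Real.log_le_sub_one_of_pos h0
    linarith

/-! ### Comparison of log |ζ| on two vertical lines -/

/-- In the disc of radius `19 / 10` about `2 + it`, which stays in `Re s ≥ 1 / 10`, the function `ζ`
grows at most linearly in `t`, while at the centre it is bounded below. -/
theorem exists_log_norm_riemannZeta_bound :
    ∃ D : ℝ, 0 < D ∧ ∀ t : ℝ, 4 ≤ t → ∃ M : ℝ,
      (∀ z ∈ ball (0 : ℂ) (19 / 10), ‖riemannZeta (2 + Complex.I * t + z)‖ ≤ M) ∧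
      Real.log (M / ‖riemannZeta (2 + Complex.I * t)‖) ≤ D + Real.log t := by
  set A : ℝ := ∑' n : ℕ, ((n : ℝ) + 1) ^ (-(1 / 10 : ℝ) - 1) with hA
  have hA0 : 0 ≤ A := tsum_nonneg fun n => by positivity
  have hlogA : 0 ≤ Real.log (1 + 2 * A) := Real.log_nonneg (by linarith)
  refine ⟨Real.log (1 + 2 * A) + 2, by linarith, fun t ht => ⟨(1 + 2 * A) * t, fun z hz => ?_, ?_⟩⟩
  · rw [mem_ball_zero_iff] at hz
    have hre := abs_le.mp ((Complex.abs_re_le_norm z).trans hz.le)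
    have him := abs_le.mp ((Complex.abs_im_le_norm z).trans hz.le)
    set s : ℂ := 2 + Complex.I * t + z with hs
    have hsre : s.re = 2 + z.re := by simp [hs]
    have hsim : s.im = t + z.im := by simp [hs]
    have h1 : 1 ≤ ‖s - 1‖ := by
      have := Complex.abs_im_le_norm (s - 1)
      rw [Complex.sub_im, Complex.one_im, sub_zero, hsim] at this
      have := le_abs_self (t + z.im)
      linarith [him.1]
    have h2 : ‖s‖ ≤ 2 * t := by
      have h3 := norm_add_le (2 + Complex.I * t : ℂ) z
      have h4 := norm_add_le (2 : ℂ) (Complex.I * t)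
      rw [norm_mul, Complex.norm_I, one_mul, Complex.norm_real, Real.norm_of_nonneg (by linarith),
        RCLike.norm_ofNat] at h4
      linarith
    have h3 := norm_riemannZeta_le (ε := 1 / 10) (by norm_num) (s := s)
      (by rw [hsre]; linarith [hre.1]) (by rw [hsim]; linarith [him.1])
    rw [← hA] at h3
    have h4 : 1 / ‖s - 1‖ ≤ 1 := (div_le_one (by linarith)).mpr h1
    have h5 : ‖s‖ * A ≤ 2 * t * A := mul_le_mul_of_nonneg_right h2 hA0
    linarith
  · have h2 : (2 : ℝ) ≤ (2 + Complex.I * t : ℂ).re := by simp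
    have h3 := abs_le.mp (abs_log_norm_riemannZeta_le h2)
    have hne : riemannZeta (2 + Complex.I * t) ≠ 0 :=
      riemannZeta_ne_zero_of_one_le_re (by simp)
    rw [Real.log_div (by positivity) (norm_ne_zero_iff.mpr hne),
      Real.log_mul (by positivity) (by positivity)]
    linarith [h3.1]

/-- The bound between two lines in the strip `1 / 2 ≤ Re s ≤ 2`. Seen from `2 + it`, the points at
height within `1` of `t` lie in the disc of radius `√13 / 2 < 181 / 100`. -/
theorem lintegral_abs_log_norm_riemannZeta_sub_le_of_le_two :
    ∃ C : ℝ, 0 < C ∧ ∀ T : ℝ, 4 ≤ T → ∀ t : ℝ, T ≤ t → t ≤ 2 * T →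
      ∀ a b : ℝ, 1 / 2 ≤ a → a ≤ b → b ≤ 2 →
      ∫⁻ y in Ioc (t - 1) (t + 1), ENNReal.ofReal
        |Real.log ‖riemannZeta ((a : ℂ) + Complex.I * y)‖ -
          Real.log ‖riemannZeta ((b : ℂ) + Complex.I * y)‖| ≤
        ENNReal.ofReal (C * (b - a) * Real.log T) := by
  obtain ⟨C, hC0, hC⟩ := exists_abs_log_norm_sub_le (r := 181 / 100) (R₀ := 19 / 10)
    (by norm_num) (by norm_num)
  obtain ⟨D, hD0, hD⟩ := exists_log_norm_riemannZeta_bound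
  refine ⟨(Real.pi + 2) * C * (D + 3), by positivity, fun T hT t hTt htT a b ha hab hb => ?_⟩
  obtain ⟨M, hM, hlog⟩ := hD t (by linarith)
  set c : ℂ := 2 + Complex.I * t with hc
  have hc0 : riemannZeta (c + 0) ≠ 0 :=
    riemannZeta_ne_zero_of_one_le_re (by simp [hc])
  have hdiff : DifferentiableOn ℂ (fun z => riemannZeta (c + z)) (ball 0 (19 / 10)) := by
    intro z hz
    rw [mem_ball_zero_iff] at hz
    have him := abs_le.mp ((Complex.abs_im_le_norm z).trans hz.le)
    have hne : c + z ≠ 1 := by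
      intro h
      have := congrArg Complex.im h
      simp [hc] at this
      linarith [him.1]
    exact ((differentiableAt_riemannZeta hne).comp z (by fun_prop)).differentiableWithinAt
  obtain ⟨n, u, hn, hzero, hbd⟩ := hC (fun z => riemannZeta (c + z)) M hdiff hc0 hM
  simp only [add_zero] at hn hbd
  have hlogT : 1 ≤ Real.log T := by
    rw [Real.le_log_iff_exp_le (by linarith)]
    linarith [Real.exp_one_lt_d9]
  set K := Real.log (M / ‖riemannZeta c‖) + 1 with hK
  have hKT : K ≤ (D + 3) * Real.log T := by
    have h1 : Real.log t ≤ Real.log 2 + Real.log T := by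
      rw [← Real.log_mul (by norm_num) (by linarith)]
      exact Real.log_le_log (by linarith) htT
    have h2 := Real.log_two_lt_d9
    have h3 : D ≤ D * Real.log T := le_mul_of_one_le_right hD0.le hlogT
    linarith
  have hK0 : 0 ≤ C * K := le_trans (Nat.cast_nonneg n) hn
  have hba : 0 ≤ b - a := by linarith
  have hmem (x y : ℝ) (hx : 1 / 2 ≤ x) (hx2 : x ≤ 2) (hy : y ∈ Ioc (t - 1) (t + 1)) :
      (x : ℂ) + Complex.I * y - c ∈ closedBall (0 : ℂ) (181 / 100) := by
    have h1 : (x : ℂ) + Complex.I * y - c = ((x - 2 : ℝ) : ℂ) + ((y - t : ℝ) : ℂ) * Complex.I := by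
      rw [hc]
      push_cast
      ring
    rw [mem_closedBall_zero_iff, h1, Complex.norm_add_mul_I]
    refine Real.sqrt_le_iff.mpr ⟨by norm_num, ?_⟩
    have h2 : (x - 2) ^ 2 ≤ (3 / 2) ^ 2 := sq_le_sq' (by linarith) (by linarith)
    have h3 : (y - t) ^ 2 ≤ 1 := by
      rw [sq_le_one_iff_abs_le_one, abs_le]
      constructor <;> linarith [hy.1, hy.2]
    linarith
  -- At a zero of `ζ` the convention `log 0 = 0` breaks the pointwise bound; this concerns only the
  -- finitely many `y` that are ordinates of one of the zeros `c + u i`.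
  have hpt : ∀ᵐ y : ℝ ∂(volume.restrict (Ioc (t - 1) (t + 1))),
      ENNReal.ofReal |Real.log ‖riemannZeta ((a : ℂ) + Complex.I * y)‖ -
          Real.log ‖riemannZeta ((b : ℂ) + Complex.I * y)‖| ≤
        ∑ i, ENNReal.ofReal |Real.log ‖(a : ℂ) + Complex.I * y - (c + u i)‖ -
          Real.log ‖(b : ℂ) + Complex.I * y - (c + u i)‖| +
        ENNReal.ofReal (C * K * (b - a)) := by
    have hfin : ∀ᵐ y : ℝ, y ∉ range fun i => t + (u i).im :=
      compl_mem_ae_iff.mpr ((finite_range _).measure_zero _)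
    filter_upwards [ae_restrict_of_ae hfin, ae_restrict_mem measurableSet_Ioc] with y hy hyI
    have hne (x : ℝ) (hx : 1 / 2 ≤ x) (hx2 : x ≤ 2) :
        riemannZeta (c + ((x : ℂ) + Complex.I * y - c)) ≠ 0 := by
      intro h
      obtain ⟨i, hi⟩ := hzero _ (hmem x y hx hx2 hyI) h
      refine hy ⟨i, ?_⟩
      simp only [← hi]
      simp [hc]
    have h1 := hbd _ (hmem a y ha (hab.trans hb) hyI) _ (hmem b y (ha.trans hab) hb hyI)
      (hne a ha (hab.trans hb)) (hne b (ha.trans hab) hb)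
    have h2 : ‖(a : ℂ) + Complex.I * y - c - ((b : ℂ) + Complex.I * y - c)‖ = b - a := by
      rw [sub_sub_sub_cancel_right, add_sub_add_right_eq_sub, ← Complex.ofReal_sub,
        Complex.norm_real, Real.norm_eq_abs, abs_sub_comm, abs_of_nonneg hba]
    rw [h2, add_sub_cancel, add_sub_cancel] at h1
    simp only [sub_sub] at h1
    rw [← ENNReal.ofReal_sum_of_nonneg fun _ _ => abs_nonneg _,
      ← ENNReal.ofReal_add (Finset.sum_nonneg fun _ _ => abs_nonneg _) (mul_nonneg hK0 hba)]
    exact ENNReal.ofReal_le_ofReal h1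
  calc _ ≤ ∫⁻ y in Ioc (t - 1) (t + 1),
        (∑ i, ENNReal.ofReal |Real.log ‖(a : ℂ) + Complex.I * y - (c + u i)‖ -
          Real.log ‖(b : ℂ) + Complex.I * y - (c + u i)‖| +
        ENNReal.ofReal (C * K * (b - a))) := lintegral_mono_ae hpt
    _ = (∑ i, ∫⁻ y in Ioc (t - 1) (t + 1),
          ENNReal.ofReal |Real.log ‖(a : ℂ) + Complex.I * y - (c + u i)‖ -
            Real.log ‖(b : ℂ) + Complex.I * y - (c + u i)‖|) +
        ENNReal.ofReal (C * K * (b - a)) * ENNReal.ofReal 2 := by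
      rw [lintegral_add_right _ measurable_const, lintegral_finsetSum _ fun i _ => by fun_prop,
        setLIntegral_const, Real.volume_Ioc]
      congr 3
      ring
    _ ≤ (∑ _i : Fin n, ENNReal.ofReal (Real.pi * (b - a))) +
        ENNReal.ofReal (C * K * (b - a)) * ENNReal.ofReal 2 := by
      gcongr with i
      exact (setLIntegral_le_lintegral _ _).trans (lintegral_abs_log_norm_sub_le _ hab)
    _ = ENNReal.ofReal (n * (Real.pi * (b - a)) + C * K * (b - a) * 2) := by
      rw [Finset.sum_const, Finset.card_univ, Fintype.card_fin, nsmul_eq_mul,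
        ← ENNReal.ofReal_mul (mul_nonneg hK0 hba), ← ENNReal.ofReal_natCast,
        ← ENNReal.ofReal_mul (Nat.cast_nonneg n), ENNReal.ofReal_add]
      · have := Real.pi_pos
        positivity
      · exact mul_nonneg (mul_nonneg hK0 hba) zero_le_two
    _ ≤ ENNReal.ofReal ((Real.pi + 2) * C * (D + 3) * (b - a) * Real.log T) := by
      refine ENNReal.ofReal_le_ofReal ?_
      have hpi := Real.pi_pos
      calc n * (Real.pi * (b - a)) + C * K * (b - a) * 2
          ≤ C * K * (Real.pi * (b - a)) + C * K * (b - a) * 2 := by gcongr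
        _ = (Real.pi + 2) * C * (b - a) * K := by ring
        _ ≤ (Real.pi + 2) * C * (b - a) * ((D + 3) * Real.log T) := by gcongr
        _ = _ := by ring

/-- Beyond `σ = 2` the logarithm `log |ζ|` is bounded, and `(σ - 1 / 2) * log T ≥ 1` absorbs the
constant. -/
theorem lintegral_abs_log_norm_riemannZeta_sub_le :
    ∃ C : ℝ, 0 < C ∧ ∀ T : ℝ, 4 ≤ T → ∀ t : ℝ, T ≤ t → t ≤ 2 * T → ∀ σ : ℝ, 1 / 2 < σ →
      ∫⁻ y in Ioc (t - 1) (t + 1), ENNReal.ofReal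
        |Real.log ‖riemannZeta (((1 / 2 : ℝ) : ℂ) + Complex.I * y)‖ -
          Real.log ‖riemannZeta ((σ : ℂ) + Complex.I * y)‖| ≤
        ENNReal.ofReal (C * (σ - 1 / 2) * Real.log T) := by
  obtain ⟨C, hC0, hC⟩ := lintegral_abs_log_norm_riemannZeta_sub_le_of_le_two
  refine ⟨C + 8, by linarith, fun T hT t hTt htT σ hσ => ?_⟩
  have hlogT : 1 ≤ Real.log T := by
    rw [Real.le_log_iff_exp_le (by linarith)]
    linarith [Real.exp_one_lt_d9]
  rcases le_total σ 2 with hσ2 | hσ2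
  · refine (hC T hT t hTt htT (1 / 2) σ le_rfl hσ.le hσ2).trans (ENNReal.ofReal_le_ofReal ?_)
    have : 0 ≤ σ - 1 / 2 := by linarith
    gcongr
    linarith
  calc _ ≤ ∫⁻ y in Ioc (t - 1) (t + 1), (ENNReal.ofReal
        |Real.log ‖riemannZeta (((1 / 2 : ℝ) : ℂ) + Complex.I * y)‖ -
          Real.log ‖riemannZeta (((2 : ℝ) : ℂ) + Complex.I * y)‖| + ENNReal.ofReal 4) := by
        refine lintegral_mono fun y => ?_
        rw [← ENNReal.ofReal_add (abs_nonneg _) (by norm_num)]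
        refine ENNReal.ofReal_le_ofReal ?_
        have h1 := abs_log_norm_riemannZeta_le (s := ((2 : ℝ) : ℂ) + Complex.I * y) (by simp)
        have h2 := abs_log_norm_riemannZeta_le (s := (σ : ℂ) + Complex.I * y) (by simpa using hσ2)
        refine (abs_sub_le _ (Real.log ‖riemannZeta (((2 : ℝ) : ℂ) + Complex.I * y)‖) _).trans ?_
        gcongr
        refine (abs_sub _ _).trans ?_
        linarith
    _ ≤ ENNReal.ofReal (C * (2 - 1 / 2) * Real.log T) + ENNReal.ofReal 4 * ENNReal.ofReal 2 := by
        rw [lintegral_add_right _ measurable_const, setLIntegral_const, Real.volume_Ioc]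
        refine add_le_add (hC T hT t hTt htT (1 / 2) 2 le_rfl (by norm_num) le_rfl) ?_
        gcongr
        linarith
    _ ≤ _ := by
        rw [← ENNReal.ofReal_mul (by norm_num), ← ENNReal.ofReal_add (by positivity) (by norm_num)]
        refine ENNReal.ofReal_le_ofReal ?_
        have h1 : C * (2 - 1 / 2) * Real.log T ≤ C * (σ - 1 / 2) * Real.log T := by gcongr
        have h2 : 1 * 1 ≤ (σ - 1 / 2) * Real.log T :=
          mul_le_mul (by linarith) hlogT zero_le_one (by linarith)
        linarith

theorem aemeasurable_log_norm_riemannZeta {t : ℝ} (ht : 1 ≤ t) (x : ℝ) :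
    AEMeasurable (fun y : ℝ => Real.log ‖riemannZeta ((x : ℂ) + Complex.I * y)‖)
      (volume.restrict (Ioc (t - 1) (t + 1))) := by
  refine Real.measurable_log.comp_aemeasurable (ContinuousOn.aemeasurable ?_ measurableSet_Ioc)
  refine ContinuousOn.norm fun y hy => ?_
  have hne : (x : ℂ) + Complex.I * y ≠ 1 := by
    intro h
    have := congrArg Complex.im h
    simp at this
    linarith [hy.1]
  exact ((differentiableAt_riemannZeta hne).continuousAt.comp
    (f := fun y : ℝ => (x : ℂ) + Complex.I * y) (by fun_prop)).continuousWithinAt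

theorem proposition1 :
    ∃ C T₀ : ℝ, 0 < C ∧ ∀ T : ℝ, T₀ ≤ T → ∀ t : ℝ, T ≤ t → t ≤ 2 * T →
      ∀ σ : ℝ, 1 / 2 < σ →
        IntervalIntegrable
          (fun y : ℝ =>
            |Real.log ‖riemannZeta ((1 / 2 : ℂ) + Complex.I * (y : ℂ))‖
              - Real.log ‖riemannZeta ((σ : ℂ) + Complex.I * (y : ℂ))‖|)
          MeasureTheory.volume (t - 1) (t + 1) ∧
        ∫ y in (t - 1)..(t + 1),
            |Real.log ‖riemannZeta ((1 / 2 : ℂ) + Complex.I * (y : ℂ))‖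
              - Real.log ‖riemannZeta ((σ : ℂ) + Complex.I * (y : ℂ))‖|
          ≤ C * (σ - 1 / 2) * Real.log T := by
  obtain ⟨C, hC0, hC⟩ := lintegral_abs_log_norm_riemannZeta_sub_le
  refine ⟨C, 4, hC0, fun T hT t hTt htT σ hσ => ?_⟩
  have hle : t - 1 ≤ t + 1 := by linarith
  have hbound := hC T hT t hTt htT σ hσ
  have hmeas := ((aemeasurable_log_norm_riemannZeta (by linarith : 1 ≤ t) (1 / 2)).sub
    (aemeasurable_log_norm_riemannZeta (by linarith : 1 ≤ t) σ)).abs.aestronglyMeasurable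
  have hhalf : ((1 / 2 : ℝ) : ℂ) = 1 / 2 := by push_cast; rfl
  simp only [hhalf, Pi.sub_apply] at hbound hmeas
  refine ⟨?_, ?_⟩
  · rw [intervalIntegrable_iff_integrableOn_Ioc_of_le hle]
    refine ⟨hmeas, ?_⟩
    rw [hasFiniteIntegral_iff_ofReal (ae_of_all _ fun y => abs_nonneg _)]
    exact hbound.trans_lt ENNReal.ofReal_lt_top
  · rw [intervalIntegral.integral_of_le hle,
      integral_eq_lintegral_of_nonneg_ae (ae_of_all _ fun y => abs_nonneg _) hmeas]
    refine ENNReal.toReal_le_of_le_ofReal ?_ hbound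
    exact mul_nonneg (mul_nonneg hC0.le (by linarith)) (Real.log_nonneg (by linarith))
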